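/- For non-negative integers $n,c$, a $c$-rook placement on the $n\times n$ board is an $n\times n$ matrix of non-negative integers (the $(i,j)$ entry being the number of rooks in the cell in row $i$ and column $j$) all of whose row sums and column sums equal $c$. Its number of drops is the number of rooks, counted with multiplicity, strictly below the main diagonal, i.e. the sum of the entries $(i,j)$ with $j<i$. The generalized Eulerian number $\left\langle{n\atop k}\right\rangle_{c}$ is the number of $c$-rook placements on the $n\times n$ board with exactly $k$ drops. Then, as formal power series in $x$, \[ \sum_{n\ge0}\left\langle{n\atop 2}\right\rangle_{2}x^n=\frac{x^2-x^3-x^4-3x^5+5x^6}{(1-x)^3(1-2x)^2(1-5x+5x^2)} = x^2+11x^3+72x^4+367x^5+1630x^6+6680x^7+26082x^8+\cdots, \] \[ \sum_{n\ge0}\left\langle{n\atop 3}\right\rangle_{2}x^n=\frac{4x^3+2x^4-300x^5+1748x^6-4674x^7+7058x^8-6648x^9+4397x^{10}-2206x^{11}+625x^{12}}{(1-x)^4(1-2x)^3(1-5x+5x^2)^2(1-8x+13x^2)} = 4x^3+114x^4+1492x^5+13992x^6+109538x^7+769632x^8+\cdots, \] \[ \sum_{n\ge0}\left\langle{n\atop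 3}\right\rangle_{3}x^n=\frac{x^2-7x^3+39x^4-336x^5+1844x^6-5545x^7+9697x^8-10404x^9+7532x^{10}-4558x^{11}+2435x^{12}-700x^{13}}{(1-x)^4(1-2x)^3(1-5x+5x^2)^2(1-10x+27x^2-20x^3)} = x^2+23x^3+325x^4+3368x^5+28819x^6+218788x^7+\cdots. \] -/

import Mathlib

/-- A `c`-rook placement on the `n × n` board: `M i j` is the number of rooks in cell `(i, j)`
(several rooks may share a cell), with exactly `c` rooks in every row and every column. -/
def IsRookPlacement (c : ℕ) {n : ℕ} (M : Matrix (Fin n) (Fin n) ℕ) : Prop :=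
  (∀ i, ∑ j, M i j = c) ∧ (∀ j, ∑ i, M i j = c)

/-- The number of drops: rooks (counted with multiplicity) strictly below the main diagonal. -/
def drops {n : ℕ} (M : Matrix (Fin n) (Fin n) ℕ) : ℕ :=
  ∑ i, ∑ j, if j < i then M i j else 0

/-- The `c`-rook placements on the `n × n` board with exactly `k` drops. -/
def rookPlacements (n k c : ℕ) : Set (Matrix (Fin n) (Fin n) ℕ) :=
  {M | IsRookPlacement c M ∧ drops M = k}

/-- There are only finitely many such placements, so their `Set.ncard` is the true count. -/
theorem rookPlacements_finite (n k c : ℕ) : (rookPlacements n k c).Finite := by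
  refine (Set.finite_Iic (fun _ _ => c : Fin n → Fin n → ℕ)).subset ?_
  intro M hM i j
  have h := hM.1.1 i
  calc M i j ≤ ∑ j, M i j := Finset.single_le_sum (fun _ _ => Nat.zero_le _) (Finset.mem_univ j)
    _ = c := h

/-- The generalized Eulerian number `⟨n, k⟩_c`. -/
noncomputable def genEulerian (n k c : ℕ) : ℕ :=
  (rookPlacements n k c).ncard

/-- The generating function `∑_{n ≥ 0} ⟨n, k⟩_c x ^ n`, as a formal power series. -/
noncomputable def genEulerianGF (k c : ℕ) : PowerSeries ℚ :=
  PowerSeries.mk fun n => (genEulerian n k c : ℚ)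

open PowerSeries

/-!
The rook placements are counted by a finite transfer system. Process the indices `0, 1, 2, …` in
order, revealing row `i` and column `i` together. When some indices have been processed, the
remaining cells of processed columns all lie below the diagonal and those of processed rows all lie
above it. Hence what is left depends only on how many rooks each processed column and each processed
row still lacks and on the number `k` of drops still to be made; every rook missing in a processed
column will be a drop, so these demands add up to at most `k`. Since the order of the pending
columns (and rows) is irrelevant and satisfied ones can be forgotten, a state is a pair of
partitions of size at most `k` together with `k`, and there are only finitely many states.

The objects counted by a state are `completions`; `ncard_completions_succ` removes the first of the
remaining indices, `ncard_completions_of_embedding` and `ncard_completions_of_embedding_right`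
normalize the demands, and together they give the linear system `stateCount_succ`.

Writing `v n` for the vector of all counts with `n` indices remaining, `v (n + 1)` is the image of
`v n` under a fixed matrix. So if the coefficients `D` of the asserted denominator satisfy
`∑ i, D i • v (m - i) = 0` for one `m`, they do so for all larger `m` (`stateCount_recurrence`).
This relation with `m` the degree of the denominator, and the coefficients of the product below that
degree, are finite computations with 9, 19 and 24 states respectively, and they determine the
generating functions (`IsCertificate.genEulerianGF_mul`).
-/

/-! ### Partial rook placements -/

/-- Partial rook placements, as they look after some indices have been processed. There remain `n`
indices; `p a` is the number of rooks still missing in the pending (already processed) column `a`,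
and `q b` the number missing in the pending row `b`. An element `(L, U, M)` supplies them:
`L a i` rooks of the pending column `a` go to the remaining row `i`, `U b j` rooks of the pending
row `b` go to the remaining column `j`, and `M` fills the remaining square. Pending columns lie to
the left of all remaining rows' diagonal cells, so each of the `∑ a, p a` rooks in them is a drop;
the rooks in pending rows never are. In total `k` drops are made. -/
def completions {α β : Type} [Fintype α] [Fintype β] (c n : ℕ) (p : α → ℕ) (q : β → ℕ) (k : ℕ) :
    Set ((α → Fin n → ℕ) × (β → Fin n → ℕ) × Matrix (Fin n) (Fin n) ℕ) :=
  {x | (∀ a, ∑ i, x.1 a i = p a) ∧ (∀ b, ∑ j, x.2.1 b j = q b) ∧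
    (∀ i, ∑ a, x.1 a i + ∑ j, x.2.2 i j = c) ∧ (∀ j, ∑ b, x.2.1 b j + ∑ i, x.2.2 i j = c) ∧
    ∑ a, p a + drops x.2.2 = k}

theorem completions_finite {α β : Type} [Fintype α] [Fintype β] (c n : ℕ) (p : α → ℕ)
    (q : β → ℕ) (k : ℕ) : (completions c n p q k).Finite := by
  classical
  refine (Set.finite_Iic ((fun _ _ => c, fun _ _ => c, fun _ _ => c) :
    (α → Fin n → ℕ) × (β → Fin n → ℕ) × (Fin n → Fin n → ℕ))).subset ?_
  rintro ⟨L, U, M⟩ ⟨-, -, hr, hc, -⟩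
  refine ⟨fun a i => ?_, fun b j => ?_, fun i j => ?_⟩
  · have h := Finset.single_le_sum (f := fun a => L a i) (fun _ _ => Nat.zero_le _)
      (Finset.mem_univ a)
    have := hr i
    simp only at h this ⊢
    omega
  · have h := Finset.single_le_sum (f := fun b => U b j) (fun _ _ => Nat.zero_le _)
      (Finset.mem_univ b)
    have := hc j
    simp only at h this ⊢
    omega
  · have h := Finset.single_le_sum (f := fun j => M i j) (fun _ _ => Nat.zero_le _)
      (Finset.mem_univ j)
    have := hr i
    simp only at h this ⊢
    omega

theorem genEulerian_eq_ncard_completions (n k c : ℕ) (p q : Fin 0 → ℕ) :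
    genEulerian n k c = (completions c n p q k).ncard := by
  let f : Matrix (Fin n) (Fin n) ℕ →
    (Fin 0 → Fin n → ℕ) × (Fin 0 → Fin n → ℕ) × Matrix (Fin n) (Fin n) ℕ :=
    fun M => (finZeroElim, finZeroElim, M)
  have hf : Function.Injective f := fun M N h => congrArg (fun x => x.2.2) h
  rw [genEulerian, ← Set.ncard_image_of_injective _ hf]
  congr 1
  ext ⟨L, U, M⟩
  simp only [Set.mem_image, rookPlacements, IsRookPlacement, completions, Set.mem_ofPred_eq,
    Finset.univ_eq_empty, Finset.sum_empty, zero_add, IsEmpty.forall_iff, true_and, f,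
    Prod.mk.injEq]
  constructor
  · rintro ⟨N, ⟨⟨h1, h2⟩, h3⟩, -, -, rfl⟩
    exact ⟨h1, h2, h3⟩
  · rintro ⟨h1, h2, h3⟩
    exact ⟨M, ⟨⟨h1, h2⟩, h3⟩, Subsingleton.elim _ _, Subsingleton.elim _ _, rfl⟩

/-! ### Removing the first row and column -/

/-- Glue a first row and column onto a partial placement of `n` indices. In the result, the first
row takes `t l` rooks from pending column `l`, the first column takes `w l` rooks from pending row
`l`, and the corner cell holds `d` rooks. The remaining rooks of the first column and the first row
are those which `x` records at pending column `0` and pending row `0`. -/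
def prepend {a b n : ℕ} (t : Fin a → ℕ) (w : Fin b → ℕ) (d : ℕ)
    (x : (Fin (a + 1) → Fin n → ℕ) × (Fin (b + 1) → Fin n → ℕ) × Matrix (Fin n) (Fin n) ℕ) :
    (Fin a → Fin (n + 1) → ℕ) × (Fin b → Fin (n + 1) → ℕ) ×
      Matrix (Fin (n + 1)) (Fin (n + 1)) ℕ :=
  (fun l => Fin.cons (t l) (x.1 l.succ), fun l => Fin.cons (w l) (x.2.1 l.succ),
    Fin.cons (Fin.cons d (x.2.1 0)) fun i => Fin.cons (x.1 0 i) (x.2.2 i))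

theorem prepend_injective {a b n : ℕ} (t : Fin a → ℕ) (w : Fin b → ℕ) (d : ℕ) :
    Function.Injective (prepend (n := n) t w d) := by
  rintro ⟨L, U, M⟩ ⟨L', U', M'⟩ h
  have h1 : (fun l => Fin.cons (t l) (L l.succ) : Fin a → Fin (n + 1) → ℕ) =
      fun l => Fin.cons (t l) (L' l.succ) :=
    congrArg (fun y => y.1) h
  have h2 : (fun l => Fin.cons (w l) (U l.succ) : Fin b → Fin (n + 1) → ℕ) =
      fun l => Fin.cons (w l) (U' l.succ) :=
    congrArg (fun y => y.2.1) h
  have h3 : (Fin.cons (Fin.cons d (U 0)) fun i => Fin.cons (L 0 i) (M i) :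
      Fin (n + 1) → Fin (n + 1) → ℕ) =
      Fin.cons (Fin.cons d (U' 0)) fun i => Fin.cons (L' 0 i) (M' i) :=
    congrArg (fun y => y.2.2) h
  have h4 := Fin.cons_inj.1 h3
  have h5 : ∀ i, L 0 i = L' 0 i ∧ M i = M' i := fun i => Fin.cons_inj.1 (congrFun h4.2 i)
  refine Prod.ext (funext fun l => ?_) (Prod.ext (funext fun l => ?_) (funext fun i => (h5 i).2))
  · refine Fin.cases (funext fun i => (h5 i).1) (fun l => ?_) l
    exact (Fin.cons_inj.1 (congrFun h1 l)).2
  · refine Fin.cases (Fin.cons_inj.1 h4.1).2 (fun l => ?_) l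
    exact (Fin.cons_inj.1 (congrFun h2 l)).2

theorem prepend_surjective {a b n : ℕ}
    (y : (Fin a → Fin (n + 1) → ℕ) × (Fin b → Fin (n + 1) → ℕ) ×
      Matrix (Fin (n + 1)) (Fin (n + 1)) ℕ) :
    ∃ x, prepend (fun l => y.1 l 0) (fun l => y.2.1 l 0) (y.2.2 0 0) x = y := by
  refine ⟨(Fin.cons (fun i => y.2.2 i.succ 0) fun l i => y.1 l i.succ,
    Fin.cons (fun j => y.2.2 0 j.succ) fun l j => y.2.1 l j.succ,
    fun i j => y.2.2 i.succ j.succ), ?_⟩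
  refine Prod.ext (funext fun l => funext fun i => ?_)
    (Prod.ext (funext fun l => funext fun i => ?_) (funext fun i => funext fun j => ?_))
  · refine Fin.cases ?_ (fun i => ?_) i <;> simp [prepend]
  · refine Fin.cases ?_ (fun i => ?_) i <;> simp [prepend]
  · refine Fin.cases ?_ (fun i => ?_) i <;> refine Fin.cases ?_ (fun j => ?_) j <;> simp [prepend]

theorem drops_succ {n : ℕ} (M : Matrix (Fin (n + 1)) (Fin (n + 1)) ℕ) :
    drops M = ∑ i : Fin n, M i.succ 0 + drops fun i j : Fin n => M i.succ j.succ := by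
  simp [drops, Fin.sum_univ_succ, Finset.sum_add_distrib]

/-- Removing the first row and column turns a completion into a completion of the updated demands:
the old ones are reduced by `t` and `w`, and a new pending column and a new pending row appear, whose
demands are what the removed part of the first column and row leaves missing. -/
theorem prepend_mem_completions {a b c n k : ℕ} {p : Fin a → ℕ} {q : Fin b → ℕ}
    {t : Fin a → ℕ} {w : Fin b → ℕ} {d : ℕ}
    {x : (Fin (a + 1) → Fin n → ℕ) × (Fin (b + 1) → Fin n → ℕ) × Matrix (Fin n) (Fin n) ℕ} :
    prepend t w d x ∈ completions c (n + 1) p q k ↔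
      (t ≤ p ∧ w ≤ q ∧ ∑ l, t l + d ≤ c ∧ ∑ l, w l + d ≤ c ∧
        c - ∑ l, w l - d + ∑ l, p l ≤ k) ∧
      x ∈ completions c n (Fin.cons (c - ∑ l, w l - d) (p - t) : Fin (a + 1) → ℕ)
        (Fin.cons (c - ∑ l, t l - d) (q - w) : Fin (b + 1) → ℕ) (k - ∑ l, t l) := by
  obtain ⟨L, U, M⟩ := x
  simp only [completions, prepend, Set.mem_ofPred_eq, Fin.forall_fin_succ, Fin.sum_univ_succ,
    Fin.cons_zero, Fin.cons_succ, drops_succ, Pi.sub_apply]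
  have hM : (drops fun i j => M i j) = drops M := rfl
  have hsub : ∀ {m : ℕ} {f g : Fin m → ℕ}, f ≤ g →
      ∑ l, f l + ∑ l, (g l - f l) = ∑ l, g l := by
    intro m f g h
    rw [← Finset.sum_add_distrib]
    exact Finset.sum_congr rfl fun l _ => Nat.add_sub_of_le (h l)
  constructor
  · rintro ⟨h1, h2, ⟨h3, h3'⟩, ⟨h4, h4'⟩, h5⟩
    have ht : t ≤ p := fun l => by rw [← h1 l]; exact Nat.le_add_right _ _
    have hw : w ≤ q := fun l => by rw [← h2 l]; exact Nat.le_add_right _ _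
    have := hsub ht
    refine ⟨⟨ht, hw, by omega, by omega, by omega⟩, ⟨by omega, fun l => ?_⟩,
      ⟨by omega, fun l => ?_⟩, fun i => ?_, fun j => ?_, ?_⟩
    · have := h1 l; omega
    · have := h2 l; omega
    · have := h3' i; omega
    · have := h4' j; omega
    · omega
  · rintro ⟨⟨ht, hw, htc, hwc, hk⟩, ⟨h1, h1'⟩, ⟨h2, h2'⟩, h3, h4, h5⟩
    have := hsub ht
    refine ⟨fun l => ?_, fun l => ?_, ⟨by omega, fun i => ?_⟩, ⟨by omega, fun j => ?_⟩, ?_⟩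
    · have := h1' l; have : t l ≤ p l := ht l; omega
    · have := h2' l; have : w l ≤ q l := hw l; omega
    · have := h3 i; omega
    · have := h4 j; omega
    · omega

/-- The possible contents `(t, w, d)` of the first row and column outside the remaining square: the
rooks taken from the pending columns and rows, and the corner. The last condition discards the
contents which leave more rooks owed to pending columns than there are drops left. -/
def moves {a b : ℕ} (c : ℕ) (p : Fin a → ℕ) (q : Fin b → ℕ) (k : ℕ) :
    Finset ((Fin a → ℕ) × (Fin b → ℕ) × ℕ) :=
  (Finset.Iic p ×ˢ Finset.Iic q ×ˢ Finset.range (c + 1)).filter fun x =>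
    ∑ l, x.1 l + x.2.2 ≤ c ∧ ∑ l, x.2.1 l + x.2.2 ≤ c ∧ c - ∑ l, x.2.1 l - x.2.2 + ∑ l, p l ≤ k

theorem mem_moves {a b c k d : ℕ} {p t : Fin a → ℕ} {q w : Fin b → ℕ} :
    (t, w, d) ∈ moves c p q k ↔ t ≤ p ∧ w ≤ q ∧ ∑ l, t l + d ≤ c ∧ ∑ l, w l + d ≤ c ∧
        c - ∑ l, w l - d + ∑ l, p l ≤ k := by
  simp only [moves, Finset.mem_filter, Finset.mem_product, Finset.mem_Iic, Finset.mem_range]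
  constructor
  · rintro ⟨⟨h1, h2, -⟩, h3⟩; exact ⟨h1, h2, h3⟩
  · rintro ⟨h1, h2, h3, h4⟩; exact ⟨⟨h1, h2, by omega⟩, h3, h4⟩

theorem ncard_completions_succ {a b : ℕ} (c n : ℕ) (p : Fin a → ℕ) (q : Fin b → ℕ) (k : ℕ) :
    (completions c (n + 1) p q k).ncard = ∑ x ∈ moves c p q k,
      (completions c n (Fin.cons (c - ∑ l, x.2.1 l - x.2.2) (p - x.1) : Fin (a + 1) → ℕ)
        (Fin.cons (c - ∑ l, x.1 l - x.2.2) (q - x.2.1) : Fin (b + 1) → ℕ)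
        (k - ∑ l, x.1 l)).ncard := by
  classical
  have hfin := completions_finite c (n + 1) p q k
  rw [Set.ncard_eq_toFinset_card _ hfin, Finset.card_eq_sum_card_fiberwise
    (f := fun y => ((fun l => y.1 l 0, fun l => y.2.1 l 0, y.2.2 0 0) :
      (Fin a → ℕ) × (Fin b → ℕ) × ℕ)) (t := moves c p q k)]
  · refine Finset.sum_congr rfl fun ⟨t, w, d⟩ hx => ?_
    rw [← Set.ncard_image_of_injective _ (prepend_injective t w d), ← Set.ncard_coe_finset]
    congr 1
    ext y
    simp only [Finset.coe_filter, Set.Finite.mem_toFinset, Set.mem_ofPred_eq, Set.mem_image]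
    constructor
    · rintro ⟨hy, hyx⟩
      obtain ⟨x, hx'⟩ := prepend_surjective y
      obtain ⟨h1, h2, h3⟩ : (fun l => y.1 l 0) = t ∧ (fun l => y.2.1 l 0) = w ∧ y.2.2 0 0 = d := by
        simpa only [Prod.mk.injEq] using hyx
      rw [h1, h2, h3] at hx'
      rw [← hx'] at hy
      exact ⟨x, (prepend_mem_completions.1 hy).2, hx'⟩
    · rintro ⟨x, hx', rfl⟩
      exact ⟨prepend_mem_completions.2 ⟨mem_moves.1 hx, hx'⟩, rfl⟩
  · intro y hy
    rw [Finset.mem_coe, Set.Finite.mem_toFinset] at hy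
    obtain ⟨x, hx⟩ := prepend_surjective y
    rw [← hx] at hy
    exact mem_moves.2 (prepend_mem_completions.1 hy).1

/-! ### Normal form of the pending demands -/

/-- Only the multiset of nonzero demands of the pending columns matters: they may be reindexed, and
the columns with no missing rook may be left out. -/
theorem ncard_completions_of_embedding {α α' β : Type} [Fintype α] [Fintype α'] [Fintype β]
    (c n : ℕ) (p : α → ℕ) (q : β → ℕ) (k : ℕ) {ι : α' → α} (hι : Function.Injective ι)
    (h0 : ∀ a, a ∉ Set.range ι → p a = 0) :
    (completions c n p q k).ncard = (completions c n (p ∘ ι) q k).ncard := by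
  have hsum : ∑ a, p (ι a) = ∑ a, p a := Fintype.sum_of_injective ι hι _ _ h0 fun _ => rfl
  -- A column that needs no rook contributes the zero vector.
  have hzero : ∀ x ∈ completions c n p q k, ∀ a, a ∉ Set.range ι → ∀ i, x.1 a i = 0 := by
    intro x hx a ha i
    have h := hx.1 a
    rw [h0 a ha] at h
    exact Finset.sum_eq_zero_iff.1 h i (Finset.mem_univ i)
  refine Set.ncard_congr (fun x _ => (x.1 ∘ ι, x.2)) ?_ ?_ ?_
  · intro x hx
    have hrow : ∀ i, ∑ a, x.1 (ι a) i = ∑ a, x.1 a i := fun i =>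
      Fintype.sum_of_injective ι hι _ _ (fun a ha => hzero x hx a ha i) fun _ => rfl
    obtain ⟨h1, h2, h3, h4, h5⟩ := hx
    exact ⟨fun a => h1 (ι a), h2, fun i => (hrow i).symm ▸ h3 i, h4, hsum.symm ▸ h5⟩
  · rintro ⟨L, y⟩ ⟨L', y'⟩ hx hx' h
    obtain ⟨h1, h2⟩ := Prod.mk.inj h
    refine Prod.ext (funext fun a => funext fun i => ?_) h2
    by_cases ha : a ∈ Set.range ι
    · obtain ⟨a, rfl⟩ := ha
      exact congrFun (congrFun h1 a) i
    · exact (hzero _ hx a ha i).trans (hzero _ hx' a ha i).symm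
  · rintro ⟨L, U, M⟩ ⟨h1, h2, h3, h4, h5⟩
    have hout : ∀ a, a ∉ Set.range ι → Function.extend ι L 0 a = 0 := fun a ha =>
      Function.extend_apply' _ _ _ fun ⟨b, hb⟩ => ha ⟨b, hb⟩
    refine ⟨(Function.extend ι L 0, U, M), ⟨fun a => ?_, h2, fun i => ?_, h4, hsum ▸ h5⟩, ?_⟩
    · by_cases ha : a ∈ Set.range ι
      · obtain ⟨a, rfl⟩ := ha
        simp only [hι.extend_apply]
        exact h1 a
      · simp [hout a ha, h0 a ha]
    · rw [← h3 i]
      congr 1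
      exact (Fintype.sum_of_injective ι hι _ _ (fun a ha => by simp [hout a ha]) fun a => by
        simp only [hι.extend_apply]).symm
    · exact Prod.ext (Function.extend_comp hι L 0) rfl

theorem ncard_completions_of_embedding_right {α β β' : Type} [Fintype α] [Fintype β] [Fintype β']
    (c n : ℕ) (p : α → ℕ) (q : β → ℕ) (k : ℕ) {ι : β' → β} (hι : Function.Injective ι)
    (h0 : ∀ b, b ∉ Set.range ι → q b = 0) :
    (completions c n p q k).ncard = (completions c n p (q ∘ ι) k).ncard := by
  have hzero : ∀ x ∈ completions c n p q k, ∀ b, b ∉ Set.range ι → ∀ j, x.2.1 b j = 0 := by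
    intro x hx b hb j
    have h := hx.2.1 b
    rw [h0 b hb] at h
    exact Finset.sum_eq_zero_iff.1 h j (Finset.mem_univ j)
  refine Set.ncard_congr (fun x _ => (x.1, x.2.1 ∘ ι, x.2.2)) ?_ ?_ ?_
  · intro x hx
    have hcol : ∀ j, ∑ b, x.2.1 (ι b) j = ∑ b, x.2.1 b j := fun j =>
      Fintype.sum_of_injective ι hι _ _ (fun b hb => hzero x hx b hb j) fun _ => rfl
    obtain ⟨h1, h2, h3, h4, h5⟩ := hx
    exact ⟨h1, fun b => h2 (ι b), h3, fun j => (hcol j).symm ▸ h4 j, h5⟩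
  · rintro ⟨L, U, M⟩ ⟨L', U', M'⟩ hx hx' h
    obtain ⟨h1, h'⟩ := Prod.mk.inj h
    obtain ⟨h2, h3⟩ := Prod.mk.inj h'
    refine Prod.ext h1 (Prod.ext (funext fun b => funext fun j => ?_) h3)
    by_cases hb : b ∈ Set.range ι
    · obtain ⟨b, rfl⟩ := hb
      exact congrFun (congrFun h2 b) j
    · exact (hzero _ hx b hb j).trans (hzero _ hx' b hb j).symm
  · rintro ⟨L, U, M⟩ ⟨h1, h2, h3, h4, h5⟩
    have hout : ∀ b, b ∉ Set.range ι → Function.extend ι U 0 b = 0 := fun b hb =>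
      Function.extend_apply' _ _ _ fun ⟨a, ha⟩ => hb ⟨a, ha⟩
    refine ⟨(L, Function.extend ι U 0, M), ⟨h1, fun b => ?_, h3, fun j => ?_, h5⟩, ?_⟩
    · by_cases hb : b ∈ Set.range ι
      · obtain ⟨b, rfl⟩ := hb
        simp only [hι.extend_apply]
        exact h2 b
      · simp [hout b hb, h0 b hb]
    · rw [← h4 j]
      congr 1
      exact (Fintype.sum_of_injective ι hι _ _ (fun b hb => by simp [hout b hb]) fun b => by
        simp only [hι.extend_apply]).symm
    · exact Prod.ext rfl (Prod.ext (Function.extend_comp hι U 0) rfl)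

/-- The nonzero values of `p`, in decreasing order: the partition formed by the pending demands. -/
def pendingPart {a : ℕ} (p : Fin a → ℕ) : List ℕ :=
  ((List.ofFn p).filter (· ≠ 0)).insertionSort (· ≥ ·)

theorem exists_embedding_pendingPart {a : ℕ} (p : Fin a → ℕ) :
    ∃ ι : Fin (pendingPart p).length → Fin a, Function.Injective ι ∧
      (∀ l, l ∉ Set.range ι → p l = 0) ∧ p ∘ ι = (pendingPart p).get := by
  have hperm : (pendingPart p).Perm (((List.finRange a).filter fun l => p l ≠ 0).map p) := by
    refine (List.perm_insertionSort _ _).trans (List.Perm.of_eq ?_)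
    rw [List.ofFn_eq_map, List.filter_map]
    rfl
  obtain ⟨s, hs, hsp⟩ : ∃ s : List (Fin a), pendingPart p = s.map p ∧
      s.Perm ((List.finRange a).filter fun l => p l ≠ 0) := by
    have h := (congrFun₂ (List.eq_map_comp_perm p) (pendingPart p)
      ((List.finRange a).filter fun l => p l ≠ 0)).mpr hperm
    exact h
  have hlen : (pendingPart p).length = s.length := by rw [hs, List.length_map]
  refine ⟨fun i => s.get (i.cast hlen), fun i j hij => ?_, fun l hl => ?_, funext fun i => ?_⟩
  · have hnd : s.Nodup := hsp.nodup_iff.2 ((List.nodup_finRange a).filter _)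
    exact Fin.cast_injective hlen (List.nodup_iff_injective_get.1 hnd hij)
  · by_contra hpl
    have hmem : l ∈ s := hsp.mem_iff.2 (by simpa using hpl)
    obtain ⟨i, hi⟩ := List.mem_iff_get.1 hmem
    exact hl ⟨i.cast hlen.symm, hi⟩
  · simp [hs]

/-! ### The transfer system -/

/-- A normalized state `(λ, μ, k)`: the partitions of missing rooks in the pending columns and in
the pending rows, and the number of drops still to be made. -/
abbrev PendingState := List ℕ × List ℕ × ℕ

/-- The number of ways to complete the state `s` when `n` indices remain. -/
noncomputable def stateCount (c n : ℕ) (s : PendingState) : ℕ :=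
  (completions c n s.1.get s.2.1.get s.2.2).ncard

theorem ncard_completions_eq_stateCount {a b : ℕ} (c n : ℕ) (p : Fin a → ℕ) (q : Fin b → ℕ)
    (k : ℕ) : (completions c n p q k).ncard = stateCount c n (pendingPart p, pendingPart q, k) := by
  obtain ⟨ι, hι, h0, hp⟩ := exists_embedding_pendingPart p
  obtain ⟨κ, hκ, h0', hq⟩ := exists_embedding_pendingPart q
  rw [ncard_completions_of_embedding c n p q k hι h0,
    ncard_completions_of_embedding_right c n _ q k hκ h0', hp, hq]
  rfl

/-- The normalized states reached from `s` by processing one index, with multiplicity.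
States whose pending columns lack more rooks than there are drops left are omitted. -/
def transitions (c : ℕ) (s : PendingState) : Multiset PendingState :=
  (moves c s.1.get s.2.1.get s.2.2).val.map fun x =>
    (pendingPart (Fin.cons (c - ∑ l, x.2.1 l - x.2.2) (s.1.get - x.1) :
        Fin (s.1.length + 1) → ℕ),
      pendingPart (Fin.cons (c - ∑ l, x.1 l - x.2.2) (s.2.1.get - x.2.1) :
        Fin (s.2.1.length + 1) → ℕ),
      s.2.2 - ∑ l, x.1 l)

theorem stateCount_succ (c n : ℕ) (s : PendingState) :
    stateCount c (n + 1) s = ((transitions c s).map (stateCount c n)).sum := by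
  rw [stateCount, ncard_completions_succ, transitions, Multiset.map_map]
  exact congrArg Multiset.sum (Multiset.map_congr rfl fun x _ =>
    ncard_completions_eq_stateCount c n _ _ _)

theorem genEulerian_eq_stateCount (n k c : ℕ) : genEulerian n k c = stateCount c n ([], [], k) :=
  genEulerian_eq_ncard_completions n k c _ _

theorem stateCount_zero (c : ℕ) (s : PendingState) : stateCount c 0 s =
    if (∀ a, s.1.get a = 0) ∧ (∀ b, s.2.1.get b = 0) ∧ s.2.2 = 0 then 1 else 0 := by
  have h : completions c 0 s.1.get s.2.1.get s.2.2 =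
      if (∀ a, s.1.get a = 0) ∧ (∀ b, s.2.1.get b = 0) ∧ s.2.2 = 0 then Set.univ else ∅ := by
    ext x
    have hd : drops x.2.2 = 0 := rfl
    have hx : x ∈ completions c 0 s.1.get s.2.1.get s.2.2 ↔
        (∀ a, s.1.get a = 0) ∧ (∀ b, s.2.1.get b = 0) ∧ s.2.2 = 0 := by
      simp only [completions, Set.mem_ofPred_eq, hd, Finset.univ_eq_empty, Finset.sum_empty,
        IsEmpty.forall_iff, true_and, add_zero]
      refine ⟨fun ⟨h1, h2, h3⟩ => ⟨fun a => (h1 a).symm, fun b => (h2 b).symm, ?_⟩,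
        fun ⟨h1, h2, h3⟩ => ⟨fun a => (h1 a).symm, fun b => (h2 b).symm, ?_⟩⟩
      · rw [← h3]; exact Finset.sum_eq_zero fun a _ => (h1 a).symm
      · rw [h3]; exact Finset.sum_eq_zero fun a _ => h1 a
    rw [hx]
    split_ifs with h
    · exact ⟨fun _ => trivial, fun _ => h⟩
    · exact ⟨h, False.elim⟩
  rw [stateCount, h]
  split_ifs
  · exact Set.ncard_eq_one.2 ⟨default, Set.eq_singleton_iff_unique_mem.2
      ⟨trivial, fun x _ => Subsingleton.elim _ _⟩⟩
  · exact Set.ncard_empty _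

/-- One step of the transfer system on a vector `v` of counts indexed by the list of states `S`. The
value is the vector of counts for one more index as soon as `S` is closed under `transitions c`. -/
def advance (c : ℕ) (S : List PendingState) (v : List ℕ) : List ℕ :=
  S.map fun s => ((transitions c s).map fun t => v.getD (S.idxOf t) 0).sum

/-- The counts `stateCount c n s` for `s ∈ S` computed through the transfer system; the vector for
`n = 0` marks the state with nothing pending and no drop left. -/
def countVector (c : ℕ) (S : List PendingState) : ℕ → List ℕ
  | 0 => S.map fun s =>
      if (∀ a, s.1.get a = 0) ∧ (∀ b, s.2.1.get b = 0) ∧ s.2.2 = 0 then 1 else 0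
  | n + 1 => advance c S (countVector c S n)

theorem countVector_eq {c : ℕ} {S : List PendingState}
    (hS : ∀ s ∈ S, ∀ t ∈ transitions c s, t ∈ S) (n : ℕ) :
    countVector c S n = S.map (stateCount c n) := by
  induction n with
  | zero => exact List.map_congr_left fun s _ => (stateCount_zero c s).symm
  | succ n ih =>
    rw [countVector, ih, advance]
    refine List.map_congr_left fun s hs => ?_
    rw [stateCount_succ]
    refine congrArg Multiset.sum (Multiset.map_congr rfl fun t ht => ?_)
    have hlt := List.idxOf_lt_length_of_mem (hS s hs t ht)
    rw [List.getD_eq_getElem _ _ (by simpa using hlt), List.getElem_map, List.getElem_idxOf hlt]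

theorem countVector_getD_idxOf {c : ℕ} {S : List PendingState}
    (hS : ∀ s ∈ S, ∀ t ∈ transitions c s, t ∈ S) (n : ℕ) {s : PendingState} (hs : s ∈ S) :
    (countVector c S n).getD (S.idxOf s) 0 = stateCount c n s := by
  have hlt := List.idxOf_lt_length_of_mem hs
  rw [countVector_eq hS, List.getD_eq_getElem _ _ (by simpa using hlt), List.getElem_map,
    List.getElem_idxOf hlt]

/-! ### Linear recurrences and generating functions -/

/-- A linear relation between the count vectors of lengths `0, …, m` persists for larger lengths,
because the transfer system maps the relation at `n` to the relation at `n + 1`. The relation has to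
hold at every state of a closed set, not only at the state of interest. -/
theorem stateCount_recurrence {c m : ℕ} {S : List PendingState} {d : ℕ → ℤ}
    (hS : ∀ s ∈ S, ∀ t ∈ transitions c s, t ∈ S)
    (h : ∀ s ∈ S, ∑ i ∈ Finset.range (m + 1), d i * (stateCount c (m - i) s : ℤ) = 0)
    {n : ℕ} (hn : m ≤ n) : ∀ s ∈ S,
      ∑ i ∈ Finset.range (m + 1), d i * (stateCount c (n - i) s : ℤ) = 0 := by
  induction n, hn using Nat.le_induction with
  | base => exact h
  | succ n hn ih =>
    intro s hs
    have hstep : ∀ i ∈ Finset.range (m + 1), d i * (stateCount c (n + 1 - i) s : ℤ) =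
        ((transitions c s).map fun t => d i * (stateCount c (n - i) t : ℤ)).sum := by
      intro i hi
      have hi' : n + 1 - i = n - i + 1 := by have := Finset.mem_range.1 hi; omega
      rw [hi', stateCount_succ, Nat.cast_multiset_sum, Multiset.map_map, Multiset.sum_map_mul_left]
      rfl
    rw [Finset.sum_congr rfl hstep, ← Multiset.sum_map_sum]
    refine Multiset.sum_eq_zero fun z hz => ?_
    obtain ⟨t, ht, rfl⟩ := Multiset.mem_map.1 hz
    exact ih t (hS s hs t ht)

/-- The polynomial with the given list of coefficients, constant term first, as a power series. -/
noncomputable def ofList (l : List ℤ) : PowerSeries ℚ :=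
  PowerSeries.mk fun n => (l.getD n 0 : ℚ)

theorem ofList_nil : ofList [] = 0 := by
  ext n
  simp [ofList]

theorem ofList_cons (a : ℤ) (l : List ℤ) :
    ofList (a :: l) = (a : PowerSeries ℚ) + X * ofList l := by
  rw [← map_intCast (C (R := ℚ)) a]
  ext n
  cases n with
  | zero => simp [ofList]
  | succ n => simp [ofList, coeff_succ_X_mul, -map_intCast]

/-- A finite verification that `genEulerianGF k c` is the quotient of the polynomials with
coefficient lists `N` and `D`: the states `S` are closed under transitions, `D` annihilates the first `m + 1`
count vectors, and the first `m` coefficients of the product with `D` are those of `N`. -/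
abbrev IsCertificate (c k m : ℕ) (S : List PendingState) (D N : List ℤ) : Prop :=
  (([], [], k) ∈ S ∧ D.length ≤ m + 1 ∧ N.length ≤ m) ∧
  (∀ s ∈ S, ∀ t ∈ transitions c s, t ∈ S) ∧
  (∀ s ∈ S, ∑ i ∈ Finset.range (m + 1),
    D.getD i 0 * ((countVector c S (m - i)).getD (S.idxOf s) 0 : ℤ) = 0) ∧
  ∀ n < m, ∑ i ∈ Finset.range (n + 1),
    D.getD i 0 * ((countVector c S (n - i)).getD (S.idxOf ([], [], k)) 0 : ℤ) = N.getD n 0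

theorem IsCertificate.genEulerian_eq {c k m : ℕ} {S : List PendingState} {D N : List ℤ}
    (h : IsCertificate c k m S D N) (n : ℕ) :
    genEulerian n k c = (countVector c S n).getD (S.idxOf ([], [], k)) 0 := by
  rw [genEulerian_eq_stateCount, countVector_getD_idxOf h.2.1 n h.1.1]

theorem IsCertificate.genEulerianGF_mul {c k m : ℕ} {S : List PendingState} {D N : List ℤ}
    (h : IsCertificate c k m S D N) : genEulerianGF k c * ofList D = ofList N := by
  obtain ⟨⟨hk, hD, hN⟩, hS, hrec, hinit⟩ := h
  ext n
  have hbase : ∀ s ∈ S, ∑ i ∈ Finset.range (m + 1),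
      D.getD i 0 * (stateCount c (m - i) s : ℤ) = 0 := by
    intro s hs
    refine (Finset.sum_congr rfl fun i _ => ?_).trans (hrec s hs)
    rw [countVector_getD_idxOf hS _ hs]
  have hcoeff : ∑ i ∈ Finset.range (n + 1), D.getD i 0 * (stateCount c (n - i) ([], [], k) : ℤ) =
      N.getD n 0 := by
    rcases lt_or_ge n m with hn | hn
    · rw [← hinit n hn]
      exact Finset.sum_congr rfl fun i _ => by rw [countVector_getD_idxOf hS _ hk]
    · rw [List.getD_eq_default N _ (hN.trans hn)]
      refine Eq.trans ?_ (stateCount_recurrence hS hbase hn _ hk)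
      -- The summation range stops depending on `n`, as `D` vanishes from `m + 1` on.
      refine (Finset.sum_subset (Finset.range_subset_range.2 (Nat.succ_le_succ hn))
        fun i _ hi => ?_).symm
      have hi' : D.length ≤ i := hD.trans (not_lt.1 fun h => hi (Finset.mem_range.2 h))
      rw [List.getD_eq_default _ _ hi', zero_mul]
  rw [mul_comm, coeff_mul, Finset.Nat.sum_antidiagonal_eq_sum_range_succ_mk]
  simp only [ofList, genEulerianGF, coeff_mk, genEulerian_eq_stateCount]
  exact_mod_cast hcoeff

/-! ### The three generating functions -/

/-- The states for `c = 2` with at most two drops left. They are the `(λ, μ, k)` with `λ` and `μ`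
partitions of the same number, at most `k`, into parts at most `2`. -/
def statesTwoTwo : List PendingState :=
  [([], [], 2), ([1], [1], 2), ([1, 1], [1, 1], 2), ([1, 1], [2], 2), ([2], [1, 1], 2),
    ([2], [2], 2), ([], [], 1), ([1], [1], 1), ([], [], 0)]

/-- The states for `c = 2` with at most three drops left. -/
def statesTwoThree : List PendingState :=
  [([], [], 3), ([1], [1], 3), ([1, 1], [1, 1], 3), ([1, 1], [2], 3), ([2], [1, 1], 3),
    ([2], [2], 3), ([1, 1, 1], [1, 1, 1], 3), ([1, 1, 1], [2, 1], 3), ([2, 1], [1, 1, 1], 3),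
    ([2, 1], [2, 1], 3)] ++ statesTwoTwo

/-- The states for `c = 3` with at most three drops left. Besides the states for `c = 2` only pairs
involving the partition with the single part `3` occur. -/
def statesThreeThree : List PendingState :=
  [([1, 1, 1], [3], 3), ([2, 1], [3], 3), ([3], [1, 1, 1], 3), ([3], [2, 1], 3), ([3], [3], 3)]
    ++ statesTwoThree

/-- The coefficients of `(1 - x)³ (1 - 2x)² (1 - 5x + 5x²)`. -/
def denominatorTwoTwo : List ℤ :=
  [1, -12, 59, -155, 236, -209, 100, -20]

/-- The coefficients of the numerator of the generating function for `c = 2`, `k = 2`. -/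
def numeratorTwoTwo : List ℤ :=
  [0, 0, 1, -1, -1, -3, 5]

theorem certificateTwoTwo :
    IsCertificate 2 2 7 statesTwoTwo denominatorTwoTwo numeratorTwoTwo ∧
      (List.range 9).map (fun n =>
          (countVector 2 statesTwoTwo n).getD (statesTwoTwo.idxOf ([], [], 2)) 0) =
        [0, 0, 1, 11, 72, 367, 1630, 6680, 26082] := by
  decide +kernel

/-- The coefficients of `(1 - x)⁴ (1 - 2x)³ (1 - 5x + 5x²)² (1 - 8x + 13x²)`. -/
def denominatorTwoThree : List ℤ :=
  [1, -28, 350, -2592, 12713, -43682, 108337, -196626, 261466, -251874, 171025, -77590,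
    21100, -2600]

/-- The coefficients of the numerator of the generating function for `c = 2`, `k = 3`. -/
def numeratorTwoThree : List ℤ :=
  [0, 0, 0, 4, 2, -300, 1748, -4674, 7058, -6648, 4397, -2206, 625]

theorem certificateTwoThree :
    IsCertificate 2 3 13 statesTwoThree denominatorTwoThree numeratorTwoThree ∧
      (List.range 9).map (fun n =>
          (countVector 2 statesTwoThree n).getD (statesTwoThree.idxOf ([], [], 3)) 0) =
        [0, 0, 0, 4, 114, 1492, 13992, 109538, 769632] := by
  decide +kernel

/-- The coefficients of
`(1 - x)⁴ (1 - 2x)³ (1 - 5x + 5x²)² (1 - 10x + 27x² - 20x³)`. -/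
def denominatorThreeThree : List ℤ :=
  [1, -30, 404, -3246, 17423, -66214, 184037, -380592, 589248, -680496, 577675, -349910, 143100,
    -35400, 4000]

/-- The coefficients of the numerator of the generating function for `c = 3`, `k = 3`. -/
def numeratorThreeThree : List ℤ :=
  [0, 0, 1, -7, 39, -336, 1844, -5545, 9697, -10404, 7532, -4558, 2435, -700]

theorem certificateThreeThree :
    IsCertificate 3 3 14 statesThreeThree denominatorThreeThree numeratorThreeThree ∧
      (List.range 8).map (fun n =>
          (countVector 3 statesThreeThree n).getD (statesThreeThree.idxOf ([], [], 3)) 0) =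
        [0, 0, 1, 23, 325, 3368, 28819, 218788] := by
  decide +kernel

theorem mainTheorem2 :
    (genEulerianGF 2 2 =
        (X ^ 2 - X ^ 3 - X ^ 4 - 3 * X ^ 5 + 5 * X ^ 6) *
          ((1 - X) ^ 3 * (1 - 2 * X) ^ 2 * (1 - 5 * X + 5 * X ^ 2))⁻¹ ∧
      (List.range 9).map (fun n => genEulerian n 2 2) =
        [0, 0, 1, 11, 72, 367, 1630, 6680, 26082]) ∧
    (genEulerianGF 3 2 =
        (4 * X ^ 3 + 2 * X ^ 4 - 300 * X ^ 5 + 1748 * X ^ 6 - 4674 * X ^ 7 + 7058 * X ^ 8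
            - 6648 * X ^ 9 + 4397 * X ^ 10 - 2206 * X ^ 11 + 625 * X ^ 12) *
          ((1 - X) ^ 4 * (1 - 2 * X) ^ 3 * (1 - 5 * X + 5 * X ^ 2) ^ 2 *
            (1 - 8 * X + 13 * X ^ 2))⁻¹ ∧
      (List.range 9).map (fun n => genEulerian n 3 2) =
        [0, 0, 0, 4, 114, 1492, 13992, 109538, 769632]) ∧
    (genEulerianGF 3 3 =
        (X ^ 2 - 7 * X ^ 3 + 39 * X ^ 4 - 336 * X ^ 5 + 1844 * X ^ 6 - 5545 * X ^ 7
            + 9697 * X ^ 8 - 10404 * X ^ 9 + 7532 * X ^ 10 - 4558 * X ^ 11 + 2435 * X ^ 12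
            - 700 * X ^ 13) *
          ((1 - X) ^ 4 * (1 - 2 * X) ^ 3 * (1 - 5 * X + 5 * X ^ 2) ^ 2 *
            (1 - 10 * X + 27 * X ^ 2 - 20 * X ^ 3))⁻¹ ∧
      (List.range 8).map (fun n => genEulerian n 3 3) =
        [0, 0, 1, 23, 325, 3368, 28819, 218788]) := by
  refine ⟨⟨(PowerSeries.eq_mul_inv_iff_mul_eq ?_).2 ?_, ?_⟩,
    ⟨(PowerSeries.eq_mul_inv_iff_mul_eq ?_).2 ?_, ?_⟩,
    ⟨(PowerSeries.eq_mul_inv_iff_mul_eq ?_).2 ?_, ?_⟩⟩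
  · simp
  · convert certificateTwoTwo.1.genEulerianGF_mul using 2 <;>
      simp [denominatorTwoTwo, numeratorTwoTwo, ofList_cons, ofList_nil] <;> ring
  · simpa only [certificateTwoTwo.1.genEulerian_eq] using certificateTwoTwo.2
  · simp
  · convert certificateTwoThree.1.genEulerianGF_mul using 2 <;>
      simp [denominatorTwoThree, numeratorTwoThree, ofList_cons, ofList_nil] <;> ring
  · simpa only [certificateTwoThree.1.genEulerian_eq] using certificateTwoThree.2
  · simp
  · convert certificateThreeThree.1.genEulerianGF_mul using 2 <;>
      simp [denominatorThreeThree, numeratorThreeThree, ofList_cons, ofList_nil] <;> ring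
  · simpa only [certificateThreeThree.1.genEulerian_eq] using certificateThreeThree.2
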